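/- \textbf{Theorem (Cohomological Derived Brackets Theorem).} Let $k$ be a field of characteristic zero and let $(V,m,Q)$ be a differential algebra over $k$: $V=V_0\oplus V_1$ is a super ($\mathbb{Z}/2$-graded) vector space, $m(a,b)=ab$ is an even bilinear product on $V$ (not assumed unital, commutative or associative), and $Q$ is an odd linear operator with $Q^2=0$ and $Q(ab)=(Qa)b+(-1)^{|a|}a(Qb)$. Let $\Delta$ be an odd linear operator on $V$ with $\Delta^2=0$ and $Q\Delta+\Delta Q=0$. Assume that the product induced by $m$ on $H(V,Q)=\operatorname{Ker}(Q)/\operatorname{Im}(Q)$ is graded commutative and associative. Define multilinear operators $\Phi^r_\Delta$ on $V$, $r\ge 1$, by $\Phi^1_\Delta(a)=\Delta(a)$ and, for homogeneous $a_i$, \[ \Phi^{r+1}_\Delta(a_1,\dots,a_{r+1})=\Phi^{r}_\Delta(a_1,\dots,a_{r-1},a_ra_{r+1})-\Phi^{r}_\Delta(a_1,\dots,a_r)\,a_{r+1}-(-1)^{|a_r|(1+|a_1|+\cdots+|a_{r-1}|)}\,a_r\,\Phi^{r}_\Delta(a_1,\dots,a_{r-1},a_{r+1}). \] Then for every $r\ge1$: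 (1) if $a_1,\dots,a_r\in\operatorname{Ker}(Q)$, then $\Phi^r_\Delta(a_1,\dots,a_r)\in\operatorname{Ker}(Q)$; (2) if $a_1,\dots,a_r\in\operatorname{Ker}(Q)$ and at least one $a_i$ lies in $\operatorname{Im}(Q)$, then $\Phi^r_\Delta(a_1,\dots,a_r)\in\operatorname{Im}(Q)$. Consequently there are multilinear brackets $[-,\dots,-]_r$ on $H(V,Q)$ with $[\,[a_1],\dots,[a_r]\,]_r=[\Phi^r_\Delta(a_1,\dots,a_r)]$ for all $a_i\in\operatorname{Ker}(Q)$, and (3) these brackets form a (strict) sh-Lie ($L_\infty$) structure on the super vector space $H(V,Q)$: each bracket is odd and graded symmetric, and for every $r\ge1$ and homogeneous $x_1,\dots,x_r\in H(V,Q)$, \[ \sum_{k=1}^{r}\ \sum_{\sigma\in S_{k,r-k}}(-1)^{\epsilon}\bigl[[x_{\sigma(1)},\dots,x_{\sigma(k)}]_k,x_{\sigma(k+1)},\dots,x_{\sigma(r)}\bigr]_{r-k+1}=0, \] where $S_{k,r-k}$ is the set of permutations $\sigma$ of $\{1,\dots,r\}$ with $\sigma(1)<\cdots<\sigma(k)$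 and $\sigma(k+1)<\cdots<\sigma(r)$, and $(-1)^\epsilon$ is the Koszul sign, the product of $(-1)^{|x_{\sigma(i)}||x_{\sigma(j)}|}$ over all $i<j$ with $\sigma(i)>\sigma(j)$. -/

import Mathlib

/-- The sign `(-1)^p` attached to a parity `p : ZMod 2`. -/
def paritySign (p : ZMod 2) : ℤ := (-1) ^ p.val

/-- The Koszul sign of a permutation `σ` of `r` homogeneous elements of parities `p 0, …, p (r-1)`:
the product of the factors `(-1)^(p (σ i) * p (σ j))` over all `i < j` with `σ i > σ j`. -/
def koszulSign {r : ℕ} (p : Fin r → ZMod 2) (σ : Equiv.Perm (Fin r)) : ℤ :=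
  ∏ x : Fin r × Fin r,
    if x.1 < x.2 ∧ σ x.2 < σ x.1 then paritySign (p (σ x.1) * p (σ x.2)) else 1

/-- `(k, r - k)`-unshuffles: permutations `σ` of `Fin r` that are increasing on the first `k`
positions and on the last `r - k` positions. -/
def unshuffles (k r : ℕ) : Finset (Equiv.Perm (Fin r)) :=
  Finset.univ.filter fun σ =>
    (∀ i j : Fin r, i < j → j.val < k → σ i < σ j) ∧
    (∀ i j : Fin r, i < j → k ≤ i.val → σ i < σ j)

/-- A (strict) sh-Lie (`L_∞`) structure on a vector space `A` with a super-grading `𝒜`: a sequence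
of odd graded-symmetric multilinear brackets satisfying the Jacobi identities. The map
`bracket n` is the bracket of arity `n + 1`, so that the arities are `1, 2, 3, …`. -/
structure IsShLie {k A : Type*} [Field k] [AddCommGroup A] [Module k A]
    (𝒜 : ZMod 2 → Submodule k A)
    (bracket : (n : ℕ) → MultilinearMap k (fun _ : Fin (n + 1) => A) A) : Prop where
  /-- `A` is the direct sum of its even and odd parts. -/
  internal : DirectSum.IsInternal 𝒜
  /-- Every bracket is odd. -/
  odd : ∀ (n : ℕ) (p : Fin (n + 1) → ZMod 2) (a : Fin (n + 1) → A),
    (∀ i, a i ∈ 𝒜 (p i)) → bracket n a ∈ 𝒜 (1 + ∑ i, p i)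
  /-- Every bracket is graded symmetric. -/
  symm : ∀ (n : ℕ) (p : Fin (n + 1) → ZMod 2) (a : Fin (n + 1) → A),
    (∀ i, a i ∈ 𝒜 (p i)) → ∀ σ : Equiv.Perm (Fin (n + 1)),
      bracket n (fun i => a (σ i)) = koszulSign p σ • bracket n a
  /-- The Jacobi identity for `r = n + 1` homogeneous elements. The inner bracket has arity
  `k = j + 1`, where `1 ≤ k ≤ r`, and the outer one has arity `r - k + 1 = n - j + 1`. -/
  jacobi : ∀ (n : ℕ) (p : Fin (n + 1) → ZMod 2) (a : Fin (n + 1) → A),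
    (∀ i, a i ∈ 𝒜 (p i)) →
      ∑ j : Fin (n + 1), ∑ σ ∈ unshuffles (j.val + 1) (n + 1),
        koszulSign p σ •
          bracket (n - j.val)
            (Fin.cons
              (bracket j.val fun i : Fin (j.val + 1) =>
                a (σ ⟨i.val, by have := i.isLt; have := j.isLt; omega⟩))
              (fun i : Fin (n - j.val) =>
                a (σ ⟨j.val + 1 + i.val, by have := i.isLt; have := j.isLt; omega⟩))) = 0

/-- A differential (super)algebra `(V, m, Q)`: a super vector space `V` with an even bilinear
product `m` (not assumed unital, commutative or associative) and an odd, square-zero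
derivation `Q` of `m`. -/
structure DiffSuperalgebra (k V : Type*) [Field k] [AddCommGroup V] [Module k V] where
  /-- The even part `grade 0` and the odd part `grade 1`. -/
  grade : ZMod 2 → Submodule k V
  /-- `V` is the direct sum of its even and odd parts. -/
  decomposition : DirectSum.Decomposition grade
  /-- The product `m`. -/
  m : V →ₗ[k] V →ₗ[k] V
  m_mem : ∀ p q : ZMod 2, ∀ a ∈ grade p, ∀ b ∈ grade q, m a b ∈ grade (p + q)
  /-- The differential `Q`. -/
  Q : V →ₗ[k] V
  Q_odd : ∀ p : ZMod 2, ∀ a ∈ grade p, Q a ∈ grade (p + 1)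
  Q_sq : ∀ a : V, Q (Q a) = 0
  Q_deriv : ∀ p : ZMod 2, ∀ a ∈ grade p, ∀ b : V,
    Q (m a b) = m (Q a) b + paritySign p • m a (Q b)

namespace DiffSuperalgebra

variable {k V : Type*} [Field k] [AddCommGroup V] [Module k V] (D : DiffSuperalgebra k V)

/-- The component of `x` of parity `p`. -/
def part (p : ZMod 2) (x : V) : V :=
  letI := D.decomposition
  (DirectSum.decompose D.grade x p : V)

/-- The parity involution, `x ↦ (-1)^|x| x` on homogeneous elements. -/
def invol (x : V) : V := D.part 0 x - D.part 1 x

theorem part_add_part (x : V) : D.part 0 x + D.part 1 x = x := by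
  classical
  let _ := D.decomposition
  have h2 : ∑ i : ZMod 2, (DirectSum.decompose D.grade x i : V) = x := by
    conv_rhs => rw [← DirectSum.sum_support_decompose D.grade x]
    symm
    apply Finset.sum_subset (Finset.subset_univ _)
    intro i _ hi
    simpa using hi
  have h3 : (Finset.univ : Finset (ZMod 2)) = {0, 1} := by decide
  rw [h3, Finset.sum_pair (by decide)] at h2
  exact h2

theorem part_mem (p : ZMod 2) (x : V) : D.part p x ∈ D.grade p := by
  let _ := D.decomposition
  exact (DirectSum.decompose D.grade x p).2

theorem Q_part (a : V) (ha : D.Q a = 0) (p : ZMod 2) : D.Q (D.part p a) = 0 := by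
  let _ := D.decomposition
  have h0 := D.Q_odd 0 _ (D.part_mem 0 a)
  have h1 := D.Q_odd 1 _ (D.part_mem 1 a)
  rw [zero_add] at h0
  have e : (1 : ZMod 2) + 1 = 0 := by decide
  rw [e] at h1
  have hs : D.Q (D.part 0 a) + D.Q (D.part 1 a) = 0 := by
    rw [← map_add, D.part_add_part, ha]
  have hd : Disjoint (D.grade 1) (D.grade 0) :=
    (DirectSum.Decomposition.isInternal D.grade).submodule_iSupIndep.pairwiseDisjoint
      (by decide)
  have h0' : D.Q (D.part 0 a) ∈ D.grade 0 := by
    rw [eq_neg_of_add_eq_zero_left hs]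
    exact neg_mem h1
  have z0 : D.Q (D.part 0 a) = 0 := Submodule.disjoint_def.1 hd _ h0 h0'
  rw [z0, zero_add] at hs
  have hp : p = 0 ∨ p = 1 := by revert p; decide
  rcases hp with rfl | rfl
  · exact z0
  · exact hs

theorem Q_m_of_ker {a : V} (ha : D.Q a = 0) (b : V) :
    D.Q (D.m a b) = D.m (D.invol a) (D.Q b) := by
  have h0 := D.Q_deriv 0 _ (D.part_mem 0 a) b
  have h1 := D.Q_deriv 1 _ (D.part_mem 1 a) b
  have e0 : paritySign 0 = 1 := by decide
  have e1 : paritySign 1 = -1 := by decide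
  rw [e0, D.Q_part a ha, map_zero, LinearMap.zero_apply, zero_add, one_smul] at h0
  rw [e1, D.Q_part a ha, map_zero, LinearMap.zero_apply, zero_add, neg_smul, one_smul] at h1
  calc D.Q (D.m a b) = D.Q (D.m (D.part 0 a + D.part 1 a) b) := by rw [D.part_add_part]
    _ = D.m (D.invol a) (D.Q b) := by
      rw [map_add, LinearMap.add_apply, map_add, h0, h1, invol, map_sub, LinearMap.sub_apply,
        sub_eq_add_neg]

/-- The product of two cocycles is a cocycle. -/
theorem m_mem_ker {a b : V} (ha : a ∈ LinearMap.ker D.Q) (hb : b ∈ LinearMap.ker D.Q) :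
    D.m a b ∈ LinearMap.ker D.Q := by
  rw [LinearMap.mem_ker] at *
  rw [D.Q_m_of_ker ha, hb, map_zero]

/-- A coboundary times a cocycle is a coboundary. -/
theorem m_mem_range_left {a b : V} (ha : a ∈ LinearMap.range D.Q) (hb : b ∈ LinearMap.ker D.Q) :
    D.m a b ∈ LinearMap.range D.Q := by
  obtain ⟨c, rfl⟩ := ha
  rw [LinearMap.mem_ker] at hb
  have h0 := D.Q_deriv 0 _ (D.part_mem 0 c) b
  have h1 := D.Q_deriv 1 _ (D.part_mem 1 c) b
  rw [hb, map_zero, smul_zero, add_zero] at h0 h1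
  refine ⟨D.m c b, ?_⟩
  calc D.Q (D.m c b) = D.Q (D.m (D.part 0 c + D.part 1 c) b) := by rw [D.part_add_part]
    _ = D.m (D.Q (D.part 0 c + D.part 1 c)) b := by
      rw [map_add, LinearMap.add_apply, map_add, h0, h1, map_add, map_add, LinearMap.add_apply]
    _ = D.m (D.Q c) b := by rw [D.part_add_part]

/-- A cocycle times a coboundary is a coboundary. -/
theorem m_mem_range_right {a b : V} (ha : a ∈ LinearMap.ker D.Q) (hb : b ∈ LinearMap.range D.Q) :
    D.m a b ∈ LinearMap.range D.Q := by
  obtain ⟨c, rfl⟩ := hb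
  rw [LinearMap.mem_ker] at ha
  have k0 := D.Q_deriv 0 _ (D.part_mem 0 a) c
  have k1 := D.Q_deriv 1 _ (D.part_mem 1 a) c
  have e0 : paritySign 0 = 1 := by decide
  have e1 : paritySign 1 = -1 := by decide
  rw [e0, D.Q_part a ha, map_zero, LinearMap.zero_apply, zero_add, one_smul] at k0
  rw [e1, D.Q_part a ha, map_zero, LinearMap.zero_apply, zero_add, neg_smul, one_smul] at k1
  refine ⟨D.m (D.invol a) c, ?_⟩
  rw [invol, map_sub, LinearMap.sub_apply, map_sub, k0, k1, sub_neg_eq_add,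
    ← LinearMap.add_apply, ← map_add, D.part_add_part]

/-- The cohomology `H(V, Q) = Ker Q / Im Q`. -/
abbrev H : Type _ :=
  LinearMap.ker D.Q ⧸ (LinearMap.range D.Q).submoduleOf (LinearMap.ker D.Q)

/-- The cohomology class of a cocycle. -/
abbrev toH : LinearMap.ker D.Q →ₗ[k] D.H :=
  ((LinearMap.range D.Q).submoduleOf (LinearMap.ker D.Q)).mkQ

/-- The grading of `H(V, Q)`: classes of cocycles of parity `p`. -/
def gradeH (p : ZMod 2) : Submodule k D.H :=
  ((D.grade p).submoduleOf (LinearMap.ker D.Q)).map D.toH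

/-- The product `m` restricted to cocycles. -/
def mKer : LinearMap.ker D.Q →ₗ[k] LinearMap.ker D.Q →ₗ[k] LinearMap.ker D.Q :=
  LinearMap.mk₂ k (fun a b => ⟨D.m a b, D.m_mem_ker a.2 b.2⟩)
    (fun a a' b => by ext; simp) (fun c a b => by ext; simp)
    (fun a b b' => by ext; simp) (fun c a b => by ext; simp)

/-- The product induced by `m` on cohomology, `[a] [b] = [m a b]`. -/
def mH : D.H →ₗ[k] D.H →ₗ[k] D.H :=
  (D.mKer.compr₂ D.toH).liftQ₂ _ _
    (by
      intro a ha
      rw [LinearMap.mem_ker]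
      ext b
      exact (Submodule.Quotient.mk_eq_zero _).2 (D.m_mem_range_left ha b.2))
    (by
      intro b hb
      rw [LinearMap.mem_ker]
      ext a
      exact (Submodule.Quotient.mk_eq_zero _).2 (D.m_mem_range_right a.2 hb))

theorem mH_toH (a b : LinearMap.ker D.Q) :
    D.mH (D.toH a) (D.toH b) = D.toH ⟨D.m a b, D.m_mem_ker a.2 b.2⟩ := rfl

/-- The operator `Φ_Δ^{n+1}(w_1, …, w_n, y)` of an odd operator `Δ`: `Φ_Δ^1 = Δ` and
`Φ^{n+2}(w, x, y) = Φ^{n+1}(w, x y) - Φ^{n+1}(w, x) y - (-1)^{|x| (1 + |w|)} x Φ^{n+1}(w, y)`,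
where `|w|` is the sum of the parities of the entries of `w`. The Koszul sign in the last term is
extended linearly to inhomogeneous arguments: the even part of `x` contributes the sign `1`, and
the odd part of `x` the sign `-(-1)^|w|`. -/
def phiAux (Δ : V →ₗ[k] V) : (n : ℕ) → (Fin n → V) → V → V
  | 0, _, y => Δ y
  | n + 1, w, y =>
    let x := w (Fin.last n)
    let w' := Fin.init w
    phiAux Δ n w' (D.m x y) - D.m (phiAux Δ n w' x) y -
      (D.m (D.part 0 x) (phiAux Δ n w' y) -
        D.m (D.part 1 x) (phiAux Δ n (fun i => D.invol (w' i)) y))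

/-- The bracket `Φ_Δ^{n+1}(a_1, …, a_{n+1})` on `V`. -/
def Phi (Δ : V →ₗ[k] V) (n : ℕ) (a : Fin (n + 1) → V) : V :=
  D.phiAux Δ n (Fin.init a) (a (Fin.last n))

end DiffSuperalgebra

/-! The recursion for the brackets uses only `Δ`, the product and the projections onto the even and
odd parts. Each of these operations preserves cocycles and descends to cohomology: `Δ` because it
anticommutes with `Q`, the product because `Q` is a derivation, the projections because `Q` is odd.
Hence the brackets on `V` preserve cocycles and induce on `H(V, Q)` the Koszul brackets of the
induced operator (`toH_phiAux`). These are multilinear, so a coboundary argument, having class zero,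
gives class zero. It remains to treat a square-zero odd operator on a graded commutative associative
algebra.

There, graded symmetry in the last two arguments is visible in one step of the recursion, symmetry
in the two before them comes from expanding twice, and the recursion propagates it to earlier
positions. Adjacent transpositions generate the symmetric group and the Koszul sign is a cocycle, so
all permutations follow.

For the Jacobi identities, the Jacobiator behaves like the Koszul bracket of the even operator `Δ²`:
it satisfies the same recursion with the sign of an even operator (`jacobiator_cons_cons`). The
extra products of two brackets cancel when the two blocks of a splitting are exchanged. Since the
Jacobiator of one argument is `Δ² = 0`, induction on the number of arguments makes all of them
vanish.

The induction runs on lists, where splittings into two blocks are generated one argument at a time.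
The unshuffle form is recovered by identifying unshuffles with subsets and comparing signs. -/

theorem paritySign_add (p q : ZMod 2) : paritySign (p + q) = paritySign p * paritySign q := by
  revert p q; decide

@[simp]
theorem paritySign_zero : paritySign 0 = 1 := by decide

@[simp]
theorem paritySign_one : paritySign 1 = -1 := by decide

theorem paritySign_mul_self (p : ZMod 2) : paritySign p * paritySign p = 1 := by
  revert p; decide

theorem zmod_two_eq_zero_or_one (p : ZMod 2) : p = 0 ∨ p = 1 := by
  revert p; decide

/-! ### Koszul brackets on lists of homogeneous elements, and signed splittings -/

namespace KoszulBracket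

variable {A : Type*}

/-- The total parity of a list of elements with parities. -/
def parity (w : List (ZMod 2 × A)) : ZMod 2 := (w.map Prod.fst).sum

@[simp]
theorem parity_nil : parity ([] : List (ZMod 2 × A)) = 0 := rfl

@[simp]
theorem parity_cons (x : ZMod 2 × A) (w : List (ZMod 2 × A)) :
    parity (x :: w) = x.1 + parity w := by
  simp [parity]

@[simp]
theorem parity_append (v w : List (ZMod 2 × A)) : parity (v ++ w) = parity v + parity w := by
  simp [parity]

variable [NonUnitalRing A]

/-- The Koszul bracket `y ↦ Φ_Δ(w, y)`. Lists of arguments are stored in reverse order: the head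
of `w` is the argument next to `y`. -/
def phi (Δ : A →+ A) : List (ZMod 2 × A) → A →+ A
  | [] => Δ
  | x :: w =>
    (phi Δ w).comp (AddMonoidHom.mulLeft x.2) - AddMonoidHom.mulLeft (phi Δ w x.2) -
      paritySign (x.1 * (1 + parity w)) • (AddMonoidHom.mulLeft x.2).comp (phi Δ w)

theorem phi_nil (Δ : A →+ A) (y : A) : phi Δ [] y = Δ y := rfl

theorem phi_cons (Δ : A →+ A) (x : ZMod 2 × A) (w : List (ZMod 2 × A)) (y : A) :
    phi Δ (x :: w) y = phi Δ w (x.2 * y) - phi Δ w x.2 * y -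
      paritySign (x.1 * (1 + parity w)) • (x.2 * phi Δ w y) := rfl

/-- The Koszul bracket of all the entries of a list (in reverse order). -/
def phiList (Δ : A →+ A) : List (ZMod 2 × A) → A
  | [] => 0
  | y :: w => phi Δ w y.2

theorem phiList_cons (Δ : A →+ A) (y : ZMod 2 × A) (w : List (ZMod 2 × A)) :
    phiList Δ (y :: w) = phi Δ w y.2 := rfl

/-- The sum of `f S T` with Koszul signs over all ways to distribute the entries of a list
(in reverse order) into two sublists `S` and `T`. -/
def splitSum : List (ZMod 2 × A) → (List (ZMod 2 × A) → List (ZMod 2 × A) → A) → A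
  | [], f => f [] []
  | x :: w, f =>
    -- The head `x` is the last argument, so it must pass all of `T` to join `S`, but nothing to
    -- join `T`.
    splitSum w fun S T => paritySign (x.1 * parity T) • f (x :: S) T + f S (x :: T)

/-- The Jacobiator of the Koszul brackets. -/
def jacobiator (Δ : A →+ A) (w : List (ZMod 2 × A)) : A :=
  -- The inner bracket, of parity `1 + parity S`, sits in the last slot instead of the first; the
  -- sign pays for moving it past `T`. The splitting with `S` empty contributes nothing, as
  -- `phiList` is zero there.
  splitSum w fun S T => paritySign ((1 + parity S) * parity T) • phi Δ T (phiList Δ S)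

/-- All entries of a list are homogeneous of the given parities. -/
def Homogeneous (𝒜 : ZMod 2 → AddSubgroup A) (w : List (ZMod 2 × A)) : Prop :=
  ∀ x ∈ w, x.2 ∈ 𝒜 x.1

theorem homogeneous_cons {𝒜 : ZMod 2 → AddSubgroup A} {x : ZMod 2 × A}
    {w : List (ZMod 2 × A)} :
    Homogeneous 𝒜 (x :: w) ↔ x.2 ∈ 𝒜 x.1 ∧ Homogeneous 𝒜 w := by
  simp [Homogeneous]

theorem homogeneous_append {𝒜 : ZMod 2 → AddSubgroup A} {v w : List (ZMod 2 × A)} :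
    Homogeneous 𝒜 (v ++ w) ↔ Homogeneous 𝒜 v ∧ Homogeneous 𝒜 w := by
  simp [Homogeneous, or_imp, forall_and]

/-- The equation `parity S + parity T = parity w` lets signs in the summands be rewritten
independently of the splitting. -/
theorem splitSum_congr (𝒜 : ZMod 2 → AddSubgroup A) {w : List (ZMod 2 × A)}
    (hw : Homogeneous 𝒜 w) {f g : List (ZMod 2 × A) → List (ZMod 2 × A) → A}
    (h : ∀ S T, Homogeneous 𝒜 S → Homogeneous 𝒜 T → parity S + parity T = parity w →
      f S T = g S T) :
    splitSum w f = splitSum w g := by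
  induction w generalizing f g with
  | nil => exact h [] [] hw hw (by simp)
  | cons x w ih =>
    rw [homogeneous_cons] at hw
    refine ih hw.2 fun S T hS hT hST => ?_
    rw [h (x :: S) T (homogeneous_cons.2 ⟨hw.1, hS⟩) hT (by simp [add_assoc, hST]),
      h S (x :: T) hS (homogeneous_cons.2 ⟨hw.1, hT⟩) (by simp [add_left_comm, hST])]

theorem splitSum_sub (w : List (ZMod 2 × A))
    (f g : List (ZMod 2 × A) → List (ZMod 2 × A) → A) :
    splitSum w (fun S T => f S T - g S T) = splitSum w f - splitSum w g := by
  induction w generalizing f g with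
  | nil => rfl
  | cons x w ih =>
    simp only [splitSum]
    rw [← ih]
    congr 1; funext S T
    rw [smul_sub]; abel

theorem map_splitSum (φ : A →+ A) (w : List (ZMod 2 × A))
    (f : List (ZMod 2 × A) → List (ZMod 2 × A) → A) :
    φ (splitSum w f) = splitSum w (fun S T => φ (f S T)) := by
  induction w generalizing f with
  | nil => rfl
  | cons x w ih => simp only [splitSum, ih, map_add, map_zsmul]

/-- Exchanging the roles of the two sublists. -/
theorem splitSum_swap (w : List (ZMod 2 × A))
    (f : List (ZMod 2 × A) → List (ZMod 2 × A) → A) :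
    splitSum w f = splitSum w fun S T => paritySign (parity S * parity T) • f T S := by
  induction w generalizing f with
  | nil => simp [splitSum]
  | cons x w ih =>
    simp only [splitSum]
    rw [ih]
    congr 1; funext S T
    simp only [parity_cons, smul_add, smul_smul, add_mul, mul_add, paritySign_add]
    rw [add_comm]
    congr 2
    · rw [← mul_assoc, paritySign_mul_self, one_mul]
    · rw [mul_comm x.1 (parity S), mul_comm]

variable {𝒜 : ZMod 2 → AddSubgroup A} {Δ : A →+ A}

theorem phi_mem (hmul : ∀ p q, ∀ x ∈ 𝒜 p, ∀ y ∈ 𝒜 q, x * y ∈ 𝒜 (p + q))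
    (hΔ : ∀ p, ∀ x ∈ 𝒜 p, Δ x ∈ 𝒜 (p + 1))
    {w : List (ZMod 2 × A)} (hw : Homogeneous 𝒜 w) {q : ZMod 2} {y : A} (hy : y ∈ 𝒜 q) :
    phi Δ w y ∈ 𝒜 (1 + parity w + q) := by
  induction w generalizing q y with
  | nil => simpa [phi_nil, add_comm] using hΔ q y hy
  | cons x w ih =>
    rw [homogeneous_cons] at hw
    rw [phi_cons]
    refine sub_mem (sub_mem ?_ ?_) (zsmul_mem ?_ _)
    · convert ih hw.2 (hmul _ _ _ hw.1 _ hy) using 2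
      simp; ring
    · convert hmul _ _ _ (ih hw.2 hw.1) _ hy using 2
      simp; ring
    · convert hmul _ _ _ hw.1 _ (ih hw.2 hy) using 2
      simp; ring

theorem phiList_mem (hmul : ∀ p q, ∀ x ∈ 𝒜 p, ∀ y ∈ 𝒜 q, x * y ∈ 𝒜 (p + q))
    (hΔ : ∀ p, ∀ x ∈ 𝒜 p, Δ x ∈ 𝒜 (p + 1))
    {w : List (ZMod 2 × A)} (hw : Homogeneous 𝒜 w) : phiList Δ w ∈ 𝒜 (1 + parity w) := by
  cases w with
  | nil => exact zero_mem _
  | cons y w =>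
    rw [homogeneous_cons] at hw
    rw [parity_cons, add_comm y.1, ← add_assoc]
    exact phi_mem hmul hΔ hw.2 hw.1


end KoszulBracket

/-! ### Graded symmetry of the Koszul brackets -/

namespace KoszulBracket

variable {A : Type*} [NonUnitalRing A] {𝒜 : ZMod 2 → AddSubgroup A} {Δ : A →+ A}

/-- Expanding the recursion twice leaves only brackets with the common arguments `w`. The two sides
then match by commuting `x` with `y`, `x` with `phi Δ w y` and `y` with `phi Δ w x`; no symmetry of
`phi Δ w` is needed. -/
theorem phi_cons_cons_swap
    (hcomm : ∀ p q, ∀ x ∈ 𝒜 p, ∀ y ∈ 𝒜 q, x * y = paritySign (p * q) • (y * x))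
    (hmul : ∀ p q, ∀ x ∈ 𝒜 p, ∀ y ∈ 𝒜 q, x * y ∈ 𝒜 (p + q))
    (hΔ : ∀ p, ∀ x ∈ 𝒜 p, Δ x ∈ 𝒜 (p + 1))
    {w : List (ZMod 2 × A)} (hw : Homogeneous 𝒜 w) {x y : ZMod 2 × A}
    (hx : x.2 ∈ 𝒜 x.1) (hy : y.2 ∈ 𝒜 y.1) :
    phi Δ (y :: x :: w) = paritySign (x.1 * y.1) • phi Δ (x :: y :: w) := by
  obtain ⟨p, x⟩ := x
  obtain ⟨q, y⟩ := y
  have h1 := hcomm _ _ _ hx _ hy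
  have h2 := hcomm _ _ _ hx _ (phi_mem hmul hΔ hw hy)
  have h3 := hcomm _ _ _ hy _ (phi_mem hmul hΔ hw hx)
  ext z
  simp only [AddMonoidHom.coe_smul, Pi.smul_apply, phi_cons, parity_cons] at h1 h2 h3 ⊢
  generalize parity w = r at *
  rcases zmod_two_eq_zero_or_one p with rfl | rfl <;>
  rcases zmod_two_eq_zero_or_one q with rfl | rfl <;>
  rcases zmod_two_eq_zero_or_one r with rfl | rfl <;>
  simp only [add_zero, zero_add, mul_zero, mul_one, CharTwo.add_self_eq_zero,
    paritySign_zero, paritySign_one, one_smul, neg_smul, mul_sub, sub_mul, mul_neg, neg_mul,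
    ← mul_assoc] at h1 h2 h3 ⊢ <;>
  simp only [h1, h2, h3, neg_mul, map_neg] <;>
  abel

/-- The recursion is linear in the shorter bracket and its sign sees only the total parity of the
earlier arguments, so a swap deeper in the list passes through it. -/
theorem phi_append_swap
    (hcomm : ∀ p q, ∀ x ∈ 𝒜 p, ∀ y ∈ 𝒜 q, x * y = paritySign (p * q) • (y * x))
    (hmul : ∀ p q, ∀ x ∈ 𝒜 p, ∀ y ∈ 𝒜 q, x * y ∈ 𝒜 (p + q))
    (hΔ : ∀ p, ∀ x ∈ 𝒜 p, Δ x ∈ 𝒜 (p + 1))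
    (v : List (ZMod 2 × A)) {w : List (ZMod 2 × A)} (hw : Homogeneous 𝒜 w) {x y : ZMod 2 × A}
    (hx : x.2 ∈ 𝒜 x.1) (hy : y.2 ∈ 𝒜 y.1) :
    phi Δ (v ++ y :: x :: w) = paritySign (x.1 * y.1) • phi Δ (v ++ x :: y :: w) := by
  induction v with
  | nil => exact phi_cons_cons_swap hcomm hmul hΔ hw hx hy
  | cons c v ih =>
    ext z
    have hp : parity (v ++ y :: x :: w) = parity (v ++ x :: y :: w) := by
      simp [add_left_comm]
    simp only [List.cons_append, AddMonoidHom.coe_smul, Pi.smul_apply, phi_cons, ih, hp,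
      smul_sub, smul_mul_assoc, mul_smul_comm]
    rw [smul_comm]

/-- The Koszul brackets are graded symmetric under adjacent transpositions. -/
theorem phiList_append_swap
    (hcomm : ∀ p q, ∀ x ∈ 𝒜 p, ∀ y ∈ 𝒜 q, x * y = paritySign (p * q) • (y * x))
    (hmul : ∀ p q, ∀ x ∈ 𝒜 p, ∀ y ∈ 𝒜 q, x * y ∈ 𝒜 (p + q))
    (hΔ : ∀ p, ∀ x ∈ 𝒜 p, Δ x ∈ 𝒜 (p + 1))
    (v : List (ZMod 2 × A)) {w : List (ZMod 2 × A)} (hw : Homogeneous 𝒜 w) {x y : ZMod 2 × A}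
    (hx : x.2 ∈ 𝒜 x.1) (hy : y.2 ∈ 𝒜 y.1) :
    phiList Δ (v ++ y :: x :: w) = paritySign (x.1 * y.1) • phiList Δ (v ++ x :: y :: w) := by
  cases v with
  | cons c v =>
    simp only [List.cons_append, phiList, phi_append_swap hcomm hmul hΔ v hw hx hy,
      AddMonoidHom.coe_smul, Pi.smul_apply]
  | nil =>
    obtain ⟨p, x⟩ := x
    obtain ⟨q, y⟩ := y
    have h1 := hcomm _ _ _ hx _ hy
    have h2 := hcomm _ _ _ hx _ (phi_mem hmul hΔ hw hy)
    have h3 := hcomm _ _ _ hy _ (phi_mem hmul hΔ hw hx)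
    simp only [List.nil_append, phiList, phi_cons] at h1 h2 h3 ⊢
    generalize parity w = r at *
    rcases zmod_two_eq_zero_or_one p with rfl | rfl <;>
    rcases zmod_two_eq_zero_or_one q with rfl | rfl <;>
    rcases zmod_two_eq_zero_or_one r with rfl | rfl <;>
    simp only [add_zero, zero_add, mul_zero, mul_one, CharTwo.add_self_eq_zero,
      paritySign_zero, paritySign_one, one_smul, neg_smul] at h1 h2 h3 ⊢ <;>
    simp only [h1, h2, h3, map_neg] <;>
    abel

/-- Moving the first argument of a Koszul bracket to the last place. -/
theorem phiList_append_singleton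
    (hcomm : ∀ p q, ∀ x ∈ 𝒜 p, ∀ y ∈ 𝒜 q, x * y = paritySign (p * q) • (y * x))
    (hmul : ∀ p q, ∀ x ∈ 𝒜 p, ∀ y ∈ 𝒜 q, x * y ∈ 𝒜 (p + q))
    (hΔ : ∀ p, ∀ x ∈ 𝒜 p, Δ x ∈ 𝒜 (p + 1))
    {w : List (ZMod 2 × A)} (hw : Homogeneous 𝒜 w) {x : ZMod 2 × A} (hx : x.2 ∈ 𝒜 x.1) :
    phiList Δ (w ++ [x]) = paritySign (x.1 * parity w) • phi Δ w x.2 := by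
  -- The prefix `v` collects the entries that `x` has yet to pass, so the induction on `w` can move
  -- `x` inside a longer list.
  suffices h : ∀ v, phiList Δ (v ++ (w ++ [x])) =
      paritySign (x.1 * parity w) • phiList Δ (v ++ x :: w) from h []
  induction w with
  | nil => simp
  | cons y w ih =>
    intro v
    rw [homogeneous_cons] at hw
    have h := ih hw.2 (v ++ [y])
    simp only [List.append_assoc, List.singleton_append] at h
    rw [List.cons_append, h, phiList_append_swap hcomm hmul hΔ v hw.2 hx hw.1, smul_smul,
      parity_cons, mul_add, paritySign_add, mul_comm]

end KoszulBracket

/-! ### Vanishing of the Jacobiators -/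

namespace KoszulBracket

variable {A : Type*} [NonUnitalRing A] {𝒜 : ZMod 2 → AddSubgroup A} {Δ : A →+ A}

/-- The Jacobiators satisfy the recursion of the Koszul brackets, up to two terms that are
exchanged by swapping the two sublists. -/
theorem jacobiator_summand
    (hcomm : ∀ p q, ∀ x ∈ 𝒜 p, ∀ y ∈ 𝒜 q, x * y = paritySign (p * q) • (y * x))
    (hmul : ∀ p q, ∀ x ∈ 𝒜 p, ∀ y ∈ 𝒜 q, x * y ∈ 𝒜 (p + q))
    (hΔ : ∀ p, ∀ x ∈ 𝒜 p, Δ x ∈ 𝒜 (p + 1))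
    {S T : List (ZMod 2 × A)} (hS : Homogeneous 𝒜 S) (hT : Homogeneous 𝒜 T) {x y : ZMod 2 × A}
    (hx : x.2 ∈ 𝒜 x.1) (hy : y.2 ∈ 𝒜 y.1)
    {f : List (ZMod 2 × A) → List (ZMod 2 × A) → A}
    (hf : f = fun S T => paritySign ((1 + parity S) * parity T) • phi Δ T (phiList Δ S)) :
    (paritySign (x.1 * parity T) •
        (paritySign (y.1 * parity T) • f (y :: x :: S) T + f (x :: S) (y :: T)) +
      (paritySign (y.1 * parity (x :: T)) • f (y :: S) (x :: T) + f S (y :: x :: T))) =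
    (paritySign ((x.1 + y.1) * parity T) • f ((x.1 + y.1, x.2 * y.2) :: S) T +
        f S ((x.1 + y.1, x.2 * y.2) :: T)) -
      (paritySign (x.1 * parity T) • f (x :: S) T + f S (x :: T)) * y.2 -
      paritySign (x.1 * (parity S + parity T)) •
        (x.2 * (paritySign (y.1 * parity T) • f (y :: S) T + f S (y :: T))) -
      (paritySign (x.1 * parity T + (1 + x.1 + parity S) * (y.1 + parity T)) •
          (phi Δ T y.2 * phi Δ S x.2) -
        paritySign (parity S * parity T) •
          paritySign (x.1 * parity S + (1 + x.1 + parity T) * (y.1 + parity S)) •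
              (phi Δ S y.2 * phi Δ T x.2)) := by
  obtain ⟨p, x⟩ := x
  obtain ⟨q, y⟩ := y
  subst hf
  have hφ := phiList_mem hmul hΔ hS
  have h1 := hcomm _ _ _ hx _ hy
  have hSx := phi_mem hmul hΔ hS hx
  have hSy := phi_mem hmul hΔ hS hy
  have hTx := phi_mem hmul hΔ hT hx
  have hTy := phi_mem hmul hΔ hT hy
  have hTφ := phi_mem hmul hΔ hT hφ
  -- Both sides are expanded by the recursion, and these commutations bring the resulting monomials
  -- to a common order. Once the four parities are fixed, only additive cancellation remains.
  have e1 := hcomm _ _ _ hy _ (phi_mem hmul hΔ hT (hmul _ _ _ hx _ hφ))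
  have e2 := congrArg (phi Δ T x * ·) (hcomm _ _ _ hφ _ hy)
  have e3 := hcomm _ _ _ hy _ hSx
  have e4 := hcomm _ _ _ hy _ hTx
  have e5 := congrArg (x * ·) (hcomm _ _ _ hTφ _ hy)
  have e6 := hcomm _ _ _ hy _ (phi_mem hmul hΔ hT hSx)
  have e7 := hcomm _ _ _ hTx _ hSy
  simp only [phiList_cons, phi_cons, parity_cons, map_sub, map_zsmul, mul_smul_comm] at *
  generalize phiList Δ S = φ at *
  generalize parity S = r at *
  generalize parity T = s at *
  rcases zmod_two_eq_zero_or_one p with rfl | rfl <;>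
  rcases zmod_two_eq_zero_or_one q with rfl | rfl <;>
  rcases zmod_two_eq_zero_or_one r with rfl | rfl <;>
  rcases zmod_two_eq_zero_or_one s with rfl | rfl <;>
  simp only [add_zero, zero_add, mul_zero, mul_one, CharTwo.add_self_eq_zero,
    paritySign_zero, paritySign_one, one_smul, neg_smul, mul_sub, sub_mul, mul_add, add_mul,
    mul_neg, neg_mul, neg_neg, ← mul_assoc] at * <;>
  simp only [h1, e1, e2, e3, e4, e5, e6, e7, neg_mul, map_neg, neg_neg] <;>
  abel

/-- This is the recursion of the brackets with `1 + parity w` replaced by `parity w`, since the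
Jacobiator composes two odd operations and is thus even. -/
theorem jacobiator_cons_cons
    (hcomm : ∀ p q, ∀ x ∈ 𝒜 p, ∀ y ∈ 𝒜 q, x * y = paritySign (p * q) • (y * x))
    (hmul : ∀ p q, ∀ x ∈ 𝒜 p, ∀ y ∈ 𝒜 q, x * y ∈ 𝒜 (p + q))
    (hΔ : ∀ p, ∀ x ∈ 𝒜 p, Δ x ∈ 𝒜 (p + 1))
    {w : List (ZMod 2 × A)} (hw : Homogeneous 𝒜 w) {x y : ZMod 2 × A}
    (hx : x.2 ∈ 𝒜 x.1) (hy : y.2 ∈ 𝒜 y.1) :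
    jacobiator Δ (y :: x :: w) =
      jacobiator Δ ((x.1 + y.1, x.2 * y.2) :: w) - jacobiator Δ (x :: w) * y.2 -
        paritySign (x.1 * parity w) • (x.2 * jacobiator Δ (y :: w)) := by
  unfold jacobiator
  generalize hf : (fun S T : List (ZMod 2 × A) =>
    paritySign ((1 + parity S) * parity T) • phi Δ T (phiList Δ S)) = f
  simp only [splitSum]
  -- Replacing `parity S + parity T` by `parity w` makes the sign in front of `x` constant, so that
  -- it leaves the sum.
  rw [splitSum_congr 𝒜 hw fun S T hS hT hST =>
    (jacobiator_summand hcomm hmul hΔ hS hT hx hy hf.symm).trans (by rw [hST])]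
  have hl := map_splitSum (paritySign (x.1 * parity w) • AddMonoidHom.mulLeft x.2) w
    fun S T => paritySign (y.1 * parity T) • f (y :: S) T + f S (y :: T)
  have hr := map_splitSum (AddMonoidHom.mulRight y.2) w
    fun S T => paritySign (x.1 * parity T) • f (x :: S) T + f S (x :: T)
  simp only [AddMonoidHom.coe_smul, Pi.smul_apply, AddMonoidHom.coe_mulLeft,
    AddMonoidHom.coe_mulRight] at hl hr
  rw [hl, hr]
  simp only [splitSum_sub]
  -- The two sums of products of brackets are images of each other under exchanging `S` and `T`,
  -- hence cancel.
  rw [← splitSum_swap w fun S T =>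
    paritySign (x.1 * parity T + (1 + x.1 + parity S) * (y.1 + parity T)) •
      (phi Δ T y.2 * phi Δ S x.2), sub_self, sub_zero]

/-- The Jacobi identities for the Koszul brackets of a square-zero odd operator on a graded
commutative associative algebra. -/
theorem jacobiator_eq_zero
    (hcomm : ∀ p q, ∀ x ∈ 𝒜 p, ∀ y ∈ 𝒜 q, x * y = paritySign (p * q) • (y * x))
    (hmul : ∀ p q, ∀ x ∈ 𝒜 p, ∀ y ∈ 𝒜 q, x * y ∈ 𝒜 (p + q))
    (hΔ : ∀ p, ∀ x ∈ 𝒜 p, Δ x ∈ 𝒜 (p + 1)) (hsq : ∀ x, Δ (Δ x) = 0) :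
    ∀ {w : List (ZMod 2 × A)}, Homogeneous 𝒜 w → jacobiator Δ w = 0
  | [], _ => by simp [jacobiator, splitSum, phiList]
  | [y], _ => by simp [jacobiator, splitSum, phiList, phi_nil, hsq]
  | y :: x :: w, h => by
    simp only [homogeneous_cons] at h
    obtain ⟨hy, hx, hw⟩ := h
    rw [jacobiator_cons_cons hcomm hmul hΔ hw hx hy,
      jacobiator_eq_zero hcomm hmul hΔ hsq (homogeneous_cons.2 ⟨hmul _ _ _ hx _ hy, hw⟩),
      jacobiator_eq_zero hcomm hmul hΔ hsq (homogeneous_cons.2 ⟨hx, hw⟩),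
      jacobiator_eq_zero hcomm hmul hΔ hsq (homogeneous_cons.2 ⟨hy, hw⟩)]
    simp
  termination_by w => w.length

end KoszulBracket

/-! ### Signed splittings as sums over subsets -/

namespace KoszulBracket

/-- The list is decreasing because arguments are stored in reverse. Its head exceeds all other
indices, so it creates inversions exactly with the elements of the second block, and only when it is
itself put in the first. -/
theorem splitSum_map_eq_sum_powerset {A ι : Type*} [NonUnitalRing A] [LinearOrder ι]
    (p : ι → ZMod 2) (a : ι → A) (l : List ι) (hl : l.Pairwise (· > ·))
    (f : List (ZMod 2 × A) → List (ZMod 2 × A) → A) :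
    splitSum (l.map fun i => (p i, a i)) f =
      ∑ S ∈ l.toFinset.powerset,
        (∏ i ∈ S, ∏ j ∈ l.toFinset \ S, if j < i then paritySign (p i * p j) else 1) •
          f ((l.filter (· ∈ S)).map fun i => (p i, a i))
            ((l.filter (· ∉ S)).map fun i => (p i, a i)) := by
  induction l generalizing f with
  | nil => simp [splitSum]
  | cons x l ih =>
    rw [List.pairwise_cons] at hl
    have hx : x ∉ l.toFinset := fun h => lt_irrefl x (hl.1 x (List.mem_toFinset.1 h))
    rw [List.map_cons, splitSum, ih hl.2, List.toFinset_cons, Finset.sum_powerset_insert hx,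
      ← Finset.sum_add_distrib]
    refine Finset.sum_congr rfl fun S hS => ?_
    rw [Finset.mem_powerset] at hS
    have hxS : x ∉ S := fun h => hx (hS h)
    have hxd : x ∉ l.toFinset \ S := fun h => hx (Finset.mem_sdiff.1 h).1
    have hfm : ∀ {i}, i ∈ l → (i ∈ insert x S ↔ i ∈ S) := fun {i} hi => by
      rw [Finset.mem_insert, or_iff_right]
      rintro rfl
      exact hx (List.mem_toFinset.2 hi)
    have h1 : l.filter (· ∈ insert x S) = l.filter (· ∈ S) :=
      List.filter_congr fun i hi => by simp only [hfm hi]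
    have h2 : l.filter (· ∉ insert x S) = l.filter (· ∉ S) :=
      List.filter_congr fun i hi => by simp only [hfm hi]
    have h3 : insert x l.toFinset \ insert x S = l.toFinset \ S := by
      ext i
      simp only [Finset.mem_sdiff, Finset.mem_insert]
      constructor
      · rintro ⟨rfl | h, h'⟩
        · simp at h'
        · exact ⟨h, fun h'' => h' (Or.inr h'')⟩
      · rintro ⟨h, h'⟩
        exact ⟨Or.inr h, by rintro (rfl | h''); exacts [hx h, h' h'']⟩
    have h4 : paritySign (p x * parity ((l.filter (· ∉ S)).map fun i => (p i, a i))) =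
        ∏ j ∈ l.toFinset \ S, if j < x then paritySign (p x * p j) else 1 := by
      have hnd : l.Nodup := hl.2.imp fun h => ne_of_gt h
      have hf : (l.filter (· ∉ S)).toFinset = l.toFinset \ S := by
        ext i; simp
      rw [← hf, List.prod_toFinset _ (hnd.filter _)]
      have hlt : ∀ j ∈ l.filter (· ∉ S), j < x := fun j hj => hl.1 j (List.mem_filter.1 hj).1
      generalize l.filter (· ∉ S) = t at hlt
      induction t with
      | nil => simp
      | cons y t iht =>
        rw [List.map_cons, parity_cons, mul_add, paritySign_add, List.map_cons, List.prod_cons,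
          iht fun j hj => hlt j (List.mem_cons_of_mem _ hj), if_pos (hlt y List.mem_cons_self)]
    have h5 : (insert x l.toFinset) \ S = insert x (l.toFinset \ S) :=
      Finset.insert_sdiff_of_notMem _ hxS
    have h6 : ∀ i ∈ S, ¬ x < i := fun i hi => not_lt_of_gt (hl.1 i (List.mem_toFinset.1 (hS hi)))
    rw [smul_add, smul_smul, add_comm]
    congr 1
    · rw [h5]
      congr 1
      · refine Finset.prod_congr rfl fun i hi => ?_
        rw [Finset.prod_insert hxd, if_neg (h6 i hi), one_mul]
      · simp [hxS]
    · rw [Finset.prod_insert hxS, h3, h4, mul_comm]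
      congr 1
      rw [List.filter_cons_of_pos (by simp), List.filter_cons_of_neg (by simp), h1, h2,
        List.map_cons]

end KoszulBracket

/-! ### Unshuffles and subsets -/

section Unshuffles

variable {k r : ℕ}

/-- The set of values of a permutation on the first `k` positions. -/
def initialValues (k : ℕ) (σ : Equiv.Perm (Fin r)) : Finset (Fin r) :=
  Finset.univ.filter fun i => (σ.symm i).val < k

theorem mem_initialValues {σ : Equiv.Perm (Fin r)} {i : Fin r} :
    i ∈ initialValues k σ ↔ (σ.symm i).val < k := by
  simp [initialValues]

/-- An unshuffle is increasing on each block, so an inversion must pair a position of the first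
block with one of the second. -/
theorem koszulSign_of_mem_unshuffles (p : Fin r → ZMod 2) {σ : Equiv.Perm (Fin r)}
    (hσ : σ ∈ unshuffles k r) :
    koszulSign p σ = ∏ i ∈ initialValues k σ, ∏ j ∈ Finset.univ \ initialValues k σ,
      if j < i then paritySign (p i * p j) else 1 := by
  simp only [unshuffles, Finset.mem_filter, Finset.mem_univ, true_and] at hσ
  have hcompl : Finset.univ \ initialValues k σ =
      Finset.univ.filter fun i => ¬ (σ.symm i).val < k := by
    ext i; simp [initialValues]
  rw [koszulSign, hcompl, initialValues, Finset.prod_filter]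
  simp only [Finset.prod_filter]
  rw [← Fintype.prod_equiv (σ.symm.prodCongr σ.symm)
    (fun x => if σ.symm x.1 < σ.symm x.2 ∧ x.2 < x.1 then paritySign (p x.1 * p x.2) else 1) _
    (fun x => by simp), Fintype.prod_prod_type]
  refine Finset.prod_congr rfl fun i _ => ?_
  have h : ∀ j, (σ.symm i < σ.symm j ∧ j < i) ↔
      (σ.symm i).val < k ∧ ¬ (σ.symm j).val < k ∧ j < i := by
    intro j
    constructor
    · rintro ⟨h1, h2⟩
      have h3 : ¬ (σ.symm j).val < k := fun h => by
        have := hσ.1 _ _ h1 h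
        simp only [Equiv.apply_symm_apply] at this
        exact lt_asymm this h2
      refine ⟨?_, h3, h2⟩
      by_contra h
      have := hσ.2 _ _ h1 (not_lt.1 h)
      simp only [Equiv.apply_symm_apply] at this
      exact lt_asymm this h2
    · rintro ⟨h1, h2, h3⟩
      exact ⟨Fin.lt_def.2 (by omega), h3⟩
  split_ifs with hi
  · refine Finset.prod_congr rfl fun j _ => ?_
    simp only [h, hi, true_and, ite_and]
  · simp only [h, hi, false_and, if_false, Finset.prod_const_one]

theorem filter_mem_initialValues {σ : Equiv.Perm (Fin r)} (hσ : σ ∈ unshuffles k r)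
    (hk : k ≤ r) :
    (List.finRange r).filter (· ∈ initialValues k σ) =
      List.ofFn fun i : Fin k => σ ⟨i.val, by omega⟩ := by
  simp only [unshuffles, Finset.mem_filter, Finset.mem_univ, true_and] at hσ
  -- Two strictly increasing lists with the same members are equal.
  refine List.Pairwise.eq_of_mem_iff (r := (· < ·))
    ((List.pairwise_lt_finRange r).filter _) ?_ fun i => ?_
  · rw [List.pairwise_ofFn]
    exact fun i j hij => hσ.1 _ _ hij j.2
  · simp only [List.mem_filter, List.mem_finRange, true_and, decide_eq_true_eq,
      mem_initialValues, List.mem_ofFn]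
    constructor
    · exact fun h => ⟨⟨_, h⟩, by simp⟩
    · rintro ⟨j, rfl⟩
      simp

theorem filter_notMem_initialValues {σ : Equiv.Perm (Fin r)} (hσ : σ ∈ unshuffles k r)
    {l : ℕ} (hl : k + l = r) :
    (List.finRange r).filter (· ∉ initialValues k σ) =
      List.ofFn fun i : Fin l => σ ⟨k + i.val, by omega⟩ := by
  simp only [unshuffles, Finset.mem_filter, Finset.mem_univ, true_and] at hσ
  refine List.Pairwise.eq_of_mem_iff (r := (· < ·))
    ((List.pairwise_lt_finRange r).filter _) ?_ fun i => ?_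
  · rw [List.pairwise_ofFn]
    exact fun i j hij => hσ.2 _ _ (Nat.add_lt_add_left hij k) (Nat.le_add_right k _)
  · simp only [List.mem_filter, List.mem_finRange, true_and, decide_eq_true_eq,
      mem_initialValues, List.mem_ofFn]
    constructor
    · intro h
      refine ⟨⟨(σ.symm i).val - k, by omega⟩, ?_⟩
      rw [← Equiv.eq_symm_apply, Fin.ext_iff]
      simp only
      omega
    · rintro ⟨j, rfl⟩
      simp

/-- Unshuffles correspond to subsets. -/
theorem sum_unshuffles {M : Type*} [AddCommMonoid M] (hk : k ≤ r) (f : Finset (Fin r) → M) :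
    ∑ σ ∈ unshuffles k r, f (initialValues k σ) =
      ∑ S ∈ (Finset.univ : Finset (Fin r)).powersetCard k, f S := by
  refine Finset.sum_bij (fun σ _ => initialValues k σ) ?_ ?_ ?_ fun _ _ => rfl
  · intro σ hσ
    have h := congrArg List.length (filter_mem_initialValues hσ hk)
    rw [List.length_ofFn, ← List.toFinset_card_of_nodup ((List.nodup_finRange r).filter _)] at h
    rw [Finset.mem_powersetCard]
    refine ⟨Finset.subset_univ _, ?_⟩
    convert h
    ext i; simp
  -- The value set determines the increasing enumeration of each block, hence the permutation.
  · intro σ hσ τ hτ h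
    have h1 := filter_mem_initialValues hσ hk
    have h2 := filter_notMem_initialValues hσ (Nat.add_sub_cancel' hk)
    rw [h, filter_mem_initialValues hτ hk, List.ofFn_inj] at h1
    rw [h, filter_notMem_initialValues hτ (Nat.add_sub_cancel' hk), List.ofFn_inj] at h2
    ext i
    by_cases hi : i.val < k
    · exact congrArg Fin.val (congrFun h1 ⟨i, hi⟩).symm
    · have := congrArg Fin.val (congrFun h2 ⟨i.val - k, by omega⟩).symm
      simpa only [Nat.add_sub_cancel' (not_lt.1 hi)] using this
  · intro S hS
    rw [Finset.mem_powersetCard] at hS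
    have hc : Sᶜ.card = r - k := by rw [Finset.card_compl, hS.2, Fintype.card_fin]
    let e := finSumEquivOfFinset hS.2 hc
    -- The unshuffle enumerates `S` increasingly, then its complement increasingly.
    let σ : Equiv.Perm (Fin r) :=
      ((finCongr (Nat.add_sub_cancel' hk).symm).trans finSumFinEquiv.symm).trans e
    have hl : ∀ i : Fin k, σ ⟨i, by omega⟩ = S.orderEmbOfFin hS.2 i := by
      intro i
      have : (⟨i, by omega⟩ : Fin (k + (r - k))) = Fin.castAdd _ i := rfl
      simp [σ, e, this]
    have hr : ∀ i : Fin (r - k), σ ⟨k + i, by omega⟩ = Sᶜ.orderEmbOfFin hc i := by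
      intro i
      have : (⟨k + i, by omega⟩ : Fin (k + (r - k))) = Fin.natAdd _ i := rfl
      simp [σ, e, this]
    have hl' : ∀ (i : Fin r) (hi : i.val < k), σ i = S.orderEmbOfFin hS.2 ⟨i, hi⟩ :=
      fun i hi => hl ⟨i, hi⟩
    have hr' : ∀ (i : Fin r) (hi : k ≤ i.val),
        σ i = Sᶜ.orderEmbOfFin hc ⟨i.val - k, by omega⟩ := fun i hi => by
      rw [← hr]
      congr 1
      exact Fin.ext (Nat.add_sub_cancel' hi).symm
    refine ⟨σ, ?_, ?_⟩
    · simp only [unshuffles, Finset.mem_filter, Finset.mem_univ, true_and]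
      constructor
      · intro i j hij hj
        rw [hl' i (lt_trans hij hj), hl' j hj]
        simpa using hij
      · intro i j hij hi
        rw [hr' i hi, hr' j (hi.trans hij.le)]
        simp only [OrderEmbedding.lt_iff_lt, Fin.mk_lt_mk]
        rw [Fin.lt_def] at hij
        omega
    · ext i
      rw [mem_initialValues]
      obtain ⟨j, rfl⟩ := σ.surjective i
      rw [Equiv.symm_apply_apply]
      by_cases hj : j.val < k
      · simp only [hj, true_iff]
        rw [hl' j hj]
        exact Finset.orderEmbOfFin_mem _ _ _
      · simp only [hj, false_iff]
        rw [hr' j (not_lt.1 hj), ← Finset.mem_compl]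
        exact Finset.orderEmbOfFin_mem _ _ _

end Unshuffles

/-! ### Koszul signs and adjacent transpositions -/

section KoszulSign

variable {r : ℕ}

/-- The Koszul sign is a cocycle. -/
theorem koszulSign_mul (p : Fin r → ZMod 2) (σ τ : Equiv.Perm (Fin r)) :
    koszulSign p (σ * τ) = koszulSign p σ * koszulSign (fun i => p (σ i)) τ := by
  -- `F i j` is the factor of `σ` at the unordered pair `{i, j}`. Its symmetry allows the product
  -- over pairs to be reindexed by `τ`, which need not preserve their order.
  let F : Fin r → Fin r → ℤ := fun i j =>
    (if i < j ∧ σ j < σ i then paritySign (p (σ i) * p (σ j)) else 1) *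
      if j < i ∧ σ i < σ j then paritySign (p (σ j) * p (σ i)) else 1
  have hF : ∀ i j, F i j = F j i := fun i j => mul_comm _ _
  have key : koszulSign p σ = ∏ x : Fin r × Fin r, if x.1 < x.2 then F (τ x.1) (τ x.2) else 1 := by
    have h1 : koszulSign p σ = ∏ x : Fin r × Fin r, if x.1 < x.2 then F x.1 x.2 else 1 := by
      refine Finset.prod_congr rfl fun x _ => ?_
      by_cases h : x.1 < x.2
      · simp [F, h, h.not_gt]
      · simp [h]
    have h2 : koszulSign p σ =
        ∏ x : Fin r × Fin r, if τ x.1 < τ x.2 then F (τ x.1) (τ x.2) else 1 := by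
      rw [h1]
      exact (Fintype.prod_equiv (τ.prodCongr τ) _ _ fun x => rfl).symm
    have h3 : (∏ x : Fin r × Fin r, if x.1 < x.2 ∧ τ x.2 < τ x.1 then F (τ x.1) (τ x.2) else 1) =
        ∏ x : Fin r × Fin r, if x.2 < x.1 ∧ τ x.1 < τ x.2 then F (τ x.1) (τ x.2) else 1 :=
      Fintype.prod_equiv (Equiv.prodComm _ _) _ _ fun x => by
        simp only [Equiv.prodComm_apply, Prod.fst_swap, Prod.snd_swap, hF (τ x.2)]
    have h4 : (∏ x : Fin r × Fin r, if x.1 < x.2 then F (τ x.1) (τ x.2) else 1) =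
        (∏ x : Fin r × Fin r, if x.1 < x.2 ∧ τ x.1 < τ x.2 then F (τ x.1) (τ x.2) else 1) *
        ∏ x : Fin r × Fin r, if x.1 < x.2 ∧ τ x.2 < τ x.1 then F (τ x.1) (τ x.2) else 1 := by
      rw [← Finset.prod_mul_distrib]
      refine Finset.prod_congr rfl fun x _ => ?_
      by_cases h : x.1 < x.2
      · rcases lt_or_gt_of_ne (τ.injective.ne h.ne) with h' | h' <;> simp [h, h', h'.not_gt]
      · simp [h]
    rw [h2, h4, h3, ← Finset.prod_mul_distrib]
    refine Finset.prod_congr rfl fun x _ => ?_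
    by_cases h : τ x.1 < τ x.2
    · have hne : x.1 ≠ x.2 := fun h' => h.ne (congrArg τ h')
      rcases lt_or_gt_of_ne hne with h' | h' <;> simp [h, h', h'.not_gt]
    · simp [h]
  rw [key, koszulSign, koszulSign, ← Finset.prod_mul_distrib]
  refine Finset.prod_congr rfl fun x _ => ?_
  by_cases h : x.1 < x.2
  · have hne := τ.injective.ne h.ne
    have hne' := σ.injective.ne hne
    -- If `τ` inverts the pair and `σ` inverts it back, the pair is no inversion of `σ * τ` and its
    -- two equal signs multiply to `1`.
    rcases lt_or_gt_of_ne hne with h1 | h1 <;> rcases lt_or_gt_of_ne hne' with h2 | h2 <;>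
      simp [F, h, h1, h2, h1.not_gt, h2.not_gt, mul_comm (p (σ (τ x.2))), paritySign_mul_self]
  · simp [h]

theorem koszulSign_one (p : Fin r → ZMod 2) : koszulSign p 1 = 1 :=
  Finset.prod_eq_one fun _ _ => if_neg fun h => lt_asymm h.1 h.2

theorem koszulSign_swap_castSucc_succ {n : ℕ} (p : Fin (n + 1) → ZMod 2) (i : Fin n) :
    koszulSign p (Equiv.swap i.castSucc i.succ) = paritySign (p i.castSucc * p i.succ) := by
  rw [koszulSign, Finset.prod_eq_single (i.castSucc, i.succ)]
  · simp [mul_comm]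
  · rintro ⟨x, y⟩ _ hxy
    refine if_neg fun h => hxy ?_
    obtain ⟨h1, h2⟩ := h
    simp only [Equiv.swap_apply_def] at h1 h2
    simp only [Prod.mk.injEq, Fin.ext_iff, Fin.lt_def, Fin.val_castSucc, Fin.val_succ] at *
    split_ifs at h2 <;> simp_all <;> omega
  · simp

/-- Graded symmetry follows from graded symmetry under adjacent transpositions. -/
theorem graded_symm_of_swap_castSucc_succ {n : ℕ} {A B : Type*} [AddCommGroup B]
    {P : ZMod 2 → A → Prop} {f : (Fin (n + 1) → A) → B}
    (hf : ∀ (p : Fin (n + 1) → ZMod 2) (a : Fin (n + 1) → A), (∀ i, P (p i) (a i)) →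
      ∀ i : Fin n, f (fun j => a (Equiv.swap i.castSucc i.succ j)) =
        paritySign (p i.castSucc * p i.succ) • f a)
    (p : Fin (n + 1) → ZMod 2) (a : Fin (n + 1) → A) (ha : ∀ i, P (p i) (a i))
    (σ : Equiv.Perm (Fin (n + 1))) :
    f (fun j => a (σ j)) = koszulSign p σ • f a := by
  have hσ : σ ∈ Submonoid.closure
      (Set.range fun i : Fin n => Equiv.swap i.castSucc i.succ) := by
    rw [Equiv.Perm.mclosure_swap_castSucc_succ]
    trivial
  induction hσ using Submonoid.closure_induction generalizing p a with
  | mem σ hσ =>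
    obtain ⟨i, rfl⟩ := hσ
    rw [koszulSign_swap_castSucc_succ]
    exact hf p a ha i
  | one => simp [koszulSign_one]
  | mul σ τ _ _ hσ hτ =>
    rw [koszulSign_mul, mul_comm, mul_smul, ← hσ p a ha]
    exact hτ (fun i => p (σ i)) (fun i => a (σ i)) fun i => ha (σ i)

theorem ofFn_eq_take_append {n : ℕ} {E : Type*} (a : Fin (n + 1) → E) (i : Fin n) :
    List.ofFn a = (List.ofFn a).take i ++ a i.castSucc :: a i.succ :: (List.ofFn a).drop (i + 2) := by
  have h1 : i.val < (List.ofFn a).length := by simp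
  have h2 : i.val + 1 < (List.ofFn a).length := by simp
  conv_lhs => rw [← List.take_append_drop i (List.ofFn a), List.drop_eq_getElem_cons h1,
    List.drop_eq_getElem_cons h2]
  simp only [List.getElem_ofFn]
  rfl

theorem ofFn_swap_eq_take_append {n : ℕ} {E : Type*} (a : Fin (n + 1) → E) (i : Fin n) :
    (List.ofFn fun j => a (Equiv.swap i.castSucc i.succ j)) =
      (List.ofFn a).take i ++ a i.succ :: a i.castSucc :: (List.ofFn a).drop (i + 2) := by
  rw [ofFn_eq_take_append _ i, Equiv.swap_apply_left, Equiv.swap_apply_right]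
  have h : ∀ j : Fin (n + 1), j.val < i.val ∨ i.val + 2 ≤ j.val →
      Equiv.swap i.castSucc i.succ j = j := fun j hj =>
    Equiv.swap_apply_of_ne_of_ne (fun h => by simp [h] at hj) (fun h => by simp [h] at hj)
  congr 1
  · refine List.ext_getElem (by simp) fun j h1 h2 => ?_
    simp only [List.length_take, List.length_ofFn] at h1
    simp only [List.getElem_take, List.getElem_ofFn]
    rw [h _ (Or.inl (by simp only; omega))]
  · congr 2
    refine List.ext_getElem (by simp) fun j h1 h2 => ?_
    simp only [List.getElem_drop, List.getElem_ofFn]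
    rw [h _ (Or.inr (by simp only; omega))]

end KoszulSign

/-! ### Symmetry and Jacobi identities for brackets of tuples -/

namespace KoszulBracket

variable {A : Type*} [NonUnitalRing A]

theorem splitSum_reverse_ofFn {n : ℕ} (p : Fin (n + 1) → ZMod 2) (a : Fin (n + 1) → A)
    (f : List (ZMod 2 × A) → List (ZMod 2 × A) → A) (hf : ∀ T, f [] T = 0) :
    splitSum (List.ofFn fun i => (p i, a i)).reverse f =
      ∑ j : Fin (n + 1), ∑ σ ∈ unshuffles (j.val + 1) (n + 1), koszulSign p σ •
        f (List.ofFn fun i : Fin (j.val + 1) =>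
            (p (σ ⟨i.val, by omega⟩), a (σ ⟨i.val, by omega⟩))).reverse
          (List.ofFn fun i : Fin (n - j.val) =>
            (p (σ ⟨j.val + 1 + i.val, by omega⟩), a (σ ⟨j.val + 1 + i.val, by omega⟩))).reverse := by
  have hE : (List.ofFn fun i => (p i, a i)).reverse =
      (List.finRange (n + 1)).reverse.map fun i => (p i, a i) := by
    rw [List.map_reverse, List.ofFn_eq_map]
  have hU : (List.finRange (n + 1)).reverse.toFinset = Finset.univ := by ext; simp
  rw [hE, splitSum_map_eq_sum_powerset p a _
    (List.pairwise_reverse.2 (List.pairwise_lt_finRange _)), hU, Finset.sum_powerset,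
    Finset.card_univ, Fintype.card_fin, Finset.sum_range_succ', Finset.powersetCard_zero,
    Finset.sum_singleton]
  -- The empty first block drops out by `hf`, so the remaining block sizes are `j + 1`, as in the
  -- Jacobi identity.
  simp only [Finset.notMem_empty, decide_false, List.filter_false, List.map_nil, hf, smul_zero,
    add_zero]
  rw [Finset.sum_range]
  refine Finset.sum_congr rfl fun j _ => ?_
  rw [← sum_unshuffles (by omega)]
  refine Finset.sum_congr rfl fun σ hσ => ?_
  rw [koszulSign_of_mem_unshuffles p hσ, List.filter_reverse, List.filter_reverse,
    filter_mem_initialValues hσ (by omega),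
    filter_notMem_initialValues hσ (l := n - j.val) (by omega), List.map_reverse,
    List.map_reverse, List.map_ofFn, List.map_ofFn]
  rfl

variable {𝒜 : ZMod 2 → AddSubgroup A} {Δ : A →+ A}

theorem homogeneous_reverse_ofFn {n : ℕ} {p : Fin n → ZMod 2} {a : Fin n → A}
    (ha : ∀ i, a i ∈ 𝒜 (p i)) : Homogeneous 𝒜 (List.ofFn fun i => (p i, a i)).reverse := by
  intro x hx
  rw [List.mem_reverse, List.mem_ofFn] at hx
  obtain ⟨i, rfl⟩ := hx
  exact ha i

theorem parity_reverse_ofFn {A : Type*} {n : ℕ} (p : Fin n → ZMod 2) (a : Fin n → A) :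
    parity (List.ofFn fun i => (p i, a i)).reverse = ∑ i, p i := by
  rw [parity, List.map_reverse, List.sum_reverse, List.map_ofFn, List.sum_ofFn]
  rfl

variable {bracket : (n : ℕ) → (Fin (n + 1) → A) → A}

theorem bracket_symm
    (hcomm : ∀ p q, ∀ x ∈ 𝒜 p, ∀ y ∈ 𝒜 q, x * y = paritySign (p * q) • (y * x))
    (hmul : ∀ p q, ∀ x ∈ 𝒜 p, ∀ y ∈ 𝒜 q, x * y ∈ 𝒜 (p + q))
    (hΔ : ∀ p, ∀ x ∈ 𝒜 p, Δ x ∈ 𝒜 (p + 1))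
    (hb : ∀ n (p : Fin (n + 1) → ZMod 2) (a : Fin (n + 1) → A), (∀ i, a i ∈ 𝒜 (p i)) →
      bracket n a = phiList Δ (List.ofFn fun i => (p i, a i)).reverse)
    (n : ℕ) (p : Fin (n + 1) → ZMod 2) (a : Fin (n + 1) → A) (ha : ∀ i, a i ∈ 𝒜 (p i))
    (σ : Equiv.Perm (Fin (n + 1))) :
    bracket n (fun i => a (σ i)) = koszulSign p σ • bracket n a := by
  refine graded_symm_of_swap_castSucc_succ (P := fun p a => a ∈ 𝒜 p) ?_ p a ha σ
  intro p a ha i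
  have h := homogeneous_reverse_ofFn ha
  rw [hb n p a ha, hb n (fun j => p (Equiv.swap i.castSucc i.succ j)) _ fun j => ha _,
    ofFn_swap_eq_take_append (fun i => (p i, a i)) i]
  have e := ofFn_eq_take_append (fun i => (p i, a i)) i
  generalize (List.ofFn fun i => (p i, a i)).take i = u at e ⊢
  generalize (List.ofFn fun i => (p i, a i)).drop (i + 2) = t at e ⊢
  rw [e] at h ⊢
  simp only [List.reverse_append, List.reverse_cons, List.append_assoc, List.cons_append,
    List.nil_append] at h ⊢
  simp only [homogeneous_append, homogeneous_cons] at h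
  rw [phiList_append_swap hcomm hmul hΔ _ h.2.2.2 (x := (p i.succ, a i.succ))
    (y := (p i.castSucc, a i.castSucc)) (ha i.succ) (ha i.castSucc), mul_comm]

theorem bracket_jacobi
    (hcomm : ∀ p q, ∀ x ∈ 𝒜 p, ∀ y ∈ 𝒜 q, x * y = paritySign (p * q) • (y * x))
    (hmul : ∀ p q, ∀ x ∈ 𝒜 p, ∀ y ∈ 𝒜 q, x * y ∈ 𝒜 (p + q))
    (hΔ : ∀ p, ∀ x ∈ 𝒜 p, Δ x ∈ 𝒜 (p + 1)) (hsq : ∀ x, Δ (Δ x) = 0)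
    (hb : ∀ n (p : Fin (n + 1) → ZMod 2) (a : Fin (n + 1) → A), (∀ i, a i ∈ 𝒜 (p i)) →
      bracket n a = phiList Δ (List.ofFn fun i => (p i, a i)).reverse)
    (n : ℕ) (p : Fin (n + 1) → ZMod 2) (a : Fin (n + 1) → A) (ha : ∀ i, a i ∈ 𝒜 (p i)) :
    ∑ j : Fin (n + 1), ∑ σ ∈ unshuffles (j.val + 1) (n + 1),
      koszulSign p σ •
        bracket (n - j.val)
          (Fin.cons
            (bracket j.val fun i : Fin (j.val + 1) => a (σ ⟨i.val, by omega⟩))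
            (fun i : Fin (n - j.val) => a (σ ⟨j.val + 1 + i.val, by omega⟩))) = 0 := by
  rw [← jacobiator_eq_zero hcomm hmul hΔ hsq (homogeneous_reverse_ofFn ha), jacobiator,
    splitSum_reverse_ofFn p a _ fun T => by simp [phiList]]
  refine Finset.sum_congr rfl fun j _ => Finset.sum_congr rfl fun σ _ => ?_
  congr 1
  have hS : Homogeneous 𝒜 _ := homogeneous_reverse_ofFn
    (p := fun i : Fin (j.val + 1) => p (σ ⟨i.val, by omega⟩)) fun i => ha (σ ⟨i.val, by omega⟩)
  have hT : Homogeneous 𝒜 _ := homogeneous_reverse_ofFn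
    (p := fun i : Fin (n - j.val) => p (σ ⟨j.val + 1 + i.val, by omega⟩))
    fun i => ha (σ ⟨j.val + 1 + i.val, by omega⟩)
  have hφ := phiList_mem hmul hΔ hS
  -- The outer bracket is applied to homogeneous arguments, the first being the inner bracket, of
  -- parity `1 + parity S`. Moving it to the last place produces the sign in `jacobiator`.
  rw [hb j.val _ _ fun i => ha (σ ⟨i.val, by omega⟩),
    hb (n - j.val) (Fin.cons _ fun i : Fin (n - j.val) => p (σ ⟨j.val + 1 + i.val, by omega⟩)) _
      (Fin.cases hφ fun i => ha _),
    List.ofFn_succ, List.reverse_cons]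
  simp only [Fin.cons_zero, Fin.cons_succ]
  rw [phiList_append_singleton hcomm hmul hΔ hT hφ]

end KoszulBracket

/-! ### Koszul brackets as multilinear maps -/

namespace KoszulBracket

section Multilinear

variable {k A : Type*} [Field k]

section Defs

variable [AddCommGroup A] [Module k A]

/-- The Koszul brackets `Φ^{n+1}` as multilinear maps, for a product `m`, an operator `Δ`, and the
projections `P₀` and `P₁` on the even and the odd part. -/
def multilinearPhi (m : A →ₗ[k] A →ₗ[k] A) (P₀ P₁ Δ : A →ₗ[k] A) :
    (n : ℕ) → MultilinearMap k (fun _ : Fin n => A) (A →ₗ[k] A)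
  | 0 => MultilinearMap.constOfIsEmpty k _ Δ
  | n + 1 =>
    -- `L₀` gathers the terms whose earlier arguments are unchanged. The odd part of the new
    -- argument needs the parity involution on the earlier ones, so `L₁` is applied to the bracket
    -- precomposed with `P₀ - P₁`.
    let L₀ : (A →ₗ[k] A) →ₗ[k] A →ₗ[k] A →ₗ[k] A :=
      { toFun := fun g => m.compr₂ g - m ∘ₗ g - m.compl₁₂ P₀ g
        map_add' := fun g h => by
          ext x y; simp only [LinearMap.sub_apply, LinearMap.add_apply, LinearMap.compr₂_apply,
            LinearMap.comp_apply, LinearMap.compl₁₂_apply, map_add]; abel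
        map_smul' := fun c g => by
          ext x y; simp [smul_sub] }
    let L₁ : (A →ₗ[k] A) →ₗ[k] A →ₗ[k] A →ₗ[k] A :=
      { toFun := fun g => m.compl₁₂ P₁ g
        map_add' := fun g h => by ext x y; simp
        map_smul' := fun c g => by ext x y; simp }
    MultilinearMap.uncurryRight (M := fun _ => A)
      (L₀.compMultilinearMap (multilinearPhi m P₀ P₁ Δ n) +
        L₁.compMultilinearMap
          ((multilinearPhi m P₀ P₁ Δ n).compLinearMap fun _ => P₀ - P₁))

variable (m : A →ₗ[k] A →ₗ[k] A) (P₀ P₁ Δ : A →ₗ[k] A)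

theorem multilinearPhi_succ (n : ℕ) (w : Fin (n + 1) → A) (y : A) :
    multilinearPhi m P₀ P₁ Δ (n + 1) w y =
      multilinearPhi m P₀ P₁ Δ n (Fin.init w) (m (w (Fin.last n)) y) -
        m (multilinearPhi m P₀ P₁ Δ n (Fin.init w) (w (Fin.last n))) y -
        (m (P₀ (w (Fin.last n))) (multilinearPhi m P₀ P₁ Δ n (Fin.init w) y) -
          m (P₁ (w (Fin.last n)))
            (multilinearPhi m P₀ P₁ Δ n (fun i => (P₀ - P₁) (Fin.init w i)) y)) := by
  rw [sub_sub_eq_add_sub, add_sub_right_comm]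
  rfl

end Defs

theorem multilinearPhi_eq_phi [NonUnitalRing A] [Module k A] {m : A →ₗ[k] A →ₗ[k] A}
    {P : ZMod 2 → A →ₗ[k] A} {Δ : A →ₗ[k] A} {𝒜 : ZMod 2 → AddSubgroup A}
    (hm : ∀ x y, m x y = x * y) (hP : ∀ p, ∀ x ∈ 𝒜 p, P p x = x)
    (hP' : ∀ p, ∀ x ∈ 𝒜 p, P (p + 1) x = 0) {n : ℕ} {p : Fin n → ZMod 2} {w : Fin n → A}
    (hw : ∀ i, w i ∈ 𝒜 (p i)) (y : A) :
    multilinearPhi m (P 0) (P 1) Δ n w y =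
      phi Δ.toAddMonoidHom (List.ofFn fun i => (p i, w i)).reverse y := by
  induction n generalizing y with
  | zero => rfl
  | succ n ih =>
    have hinit : ∀ i, (Fin.init w : Fin n → A) i ∈ 𝒜 ((Fin.init p : Fin n → ZMod 2) i) :=
      fun i => hw _
    have hlist : (List.ofFn fun i => (p i, w i)).reverse =
        (p (Fin.last n), w (Fin.last n)) :: (List.ofFn fun i : Fin n =>
          ((Fin.init p : Fin n → ZMod 2) i, (Fin.init w : Fin n → A) i)).reverse := by
      rw [List.ofFn_succ', List.concat_eq_append, List.reverse_append]
      rfl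
    have hinv : ∀ p, ∀ x ∈ 𝒜 p, (P 0 - P 1) x = ((paritySign p : ℤ) : k) • x := by
      intro p x hx
      have h1 := hP p x hx
      have h2 := hP' p x hx
      rcases zmod_two_eq_zero_or_one p with rfl | rfl
      · rw [zero_add] at h2
        simp [h1, h2]
      · rw [CharTwo.add_self_eq_zero] at h2
        simp [h1, h2]
    have hprod : multilinearPhi m (P 0) (P 1) Δ n (fun i => (P 0 - P 1) (Fin.init w i)) =
        paritySign (∑ i, (Fin.init p : Fin n → ZMod 2) i) •
          multilinearPhi m (P 0) (P 1) Δ n (Fin.init w) := by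
      have h : (fun i : Fin n => (P 0 - P 1) ((Fin.init w : Fin n → A) i)) =
          fun i => ((paritySign ((Fin.init p : Fin n → ZMod 2) i) : ℤ) : k) •
            (Fin.init w : Fin n → A) i :=
        funext fun i => hinv _ _ (hinit i)
      -- On homogeneous arguments the involution is multiplication by signs; multilinearity extracts
      -- their product, the sign of the total parity.
      rw [h, MultilinearMap.map_smul_univ, ← Int.cast_prod, Int.cast_smul_eq_zsmul]
      congr 1
      generalize (Fin.init p : Fin n → ZMod 2) = q
      clear * -
      induction n with
      | zero => simp
      | succ n ih => rw [Fin.prod_univ_succ, Fin.sum_univ_succ, paritySign_add, ih]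
    rw [multilinearPhi_succ, hprod, hlist, phi_cons, parity_reverse_ofFn]
    simp only [LinearMap.smul_apply, ih hinit, hm]
    congr 1
    have h1 := hP _ _ (hw (Fin.last n))
    have h2 := hP' _ _ (hw (Fin.last n))
    generalize p (Fin.last n) = q at *
    rcases zmod_two_eq_zero_or_one q with rfl | rfl
    · rw [zero_add] at h2
      simp [h1, h2]
    · rw [CharTwo.add_self_eq_zero] at h2
      simp [h1, h2, paritySign_add, mul_smul_comm]

end Multilinear

end KoszulBracket

/-! ### Passage to cohomology -/

namespace DiffSuperalgebra

variable {k V : Type*} [Field k] [AddCommGroup V] [Module k V] (D : DiffSuperalgebra k V)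

/-- The projection on the component of parity `p`. -/
def partLinear (p : ZMod 2) : V →ₗ[k] V where
  toFun := D.part p
  map_add' x y := by simp [part]
  map_smul' c x := by
    let _ := D.decomposition
    exact congrArg Subtype.val (congrFun (congrArg DFunLike.coe
      (DirectSum.decompose_smul D.grade c x)) p)

theorem part_of_mem {p : ZMod 2} {x : V} (hx : x ∈ D.grade p) : D.part p x = x := by
  let _ := D.decomposition
  exact DirectSum.decompose_of_mem_same D.grade hx

theorem part_of_mem_ne {p q : ZMod 2} {x : V} (hx : x ∈ D.grade p) (hpq : p ≠ q) :
    D.part q x = 0 := by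
  let _ := D.decomposition
  exact DirectSum.decompose_of_mem_ne D.grade hx hpq

/-- Since `Q` reverses parity, the projections carry coboundaries to coboundaries and so descend to
cohomology. -/
theorem part_Q (p : ZMod 2) (x : V) : D.part p (D.Q x) = D.Q (D.part (p + 1) x) := by
  have h : D.Q x = D.Q (D.part 0 x) + D.Q (D.part 1 x) := by rw [← map_add, D.part_add_part]
  have h0 := D.Q_odd 0 _ (D.part_mem 0 x)
  have h1 := D.Q_odd 1 _ (D.part_mem 1 x)
  have e : D.part p (D.Q (D.part 0 x) + D.Q (D.part 1 x)) =
      D.part p (D.Q (D.part 0 x)) + D.part p (D.Q (D.part 1 x)) := (D.partLinear p).map_add _ _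
  rw [h, e]
  rw [zero_add] at h0
  rw [CharTwo.add_self_eq_zero] at h1
  rcases zmod_two_eq_zero_or_one p with rfl | rfl
  · rw [D.part_of_mem h1, D.part_of_mem_ne h0 (by decide), zero_add, zero_add]
  · rw [D.part_of_mem h0, D.part_of_mem_ne h1 (by decide), add_zero, CharTwo.add_self_eq_zero]

/-- The operator on cohomology induced by an operator that preserves cocycles and
coboundaries. -/
def mapH (f : V →ₗ[k] V) (hk : ∀ a ∈ LinearMap.ker D.Q, f a ∈ LinearMap.ker D.Q)
    (hr : ∀ a ∈ LinearMap.range D.Q, f a ∈ LinearMap.range D.Q) : D.H →ₗ[k] D.H :=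
  Submodule.mapQ _ _ (f.restrict hk) fun a ha => hr a ha

theorem part_mem_ker (p : ZMod 2) : ∀ a ∈ LinearMap.ker D.Q, D.part p a ∈ LinearMap.ker D.Q :=
  fun a ha => D.Q_part a ha p

/-- The projection of cohomology on the component of parity `p`. -/
def partH (p : ZMod 2) : D.H →ₗ[k] D.H :=
  D.mapH (D.partLinear p) (D.part_mem_ker p) (by
    rintro _ ⟨b, rfl⟩
    exact ⟨_, (D.part_Q p b).symm⟩)

theorem partH_toH (p : ZMod 2) (a : LinearMap.ker D.Q) :
    D.partH p (D.toH a) = D.toH ⟨D.part p a, D.part_mem_ker p a a.2⟩ := rfl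

theorem mem_gradeH {p : ZMod 2} {x : D.H} :
    x ∈ D.gradeH p ↔ ∃ a : LinearMap.ker D.Q, (a : V) ∈ D.grade p ∧ D.toH a = x := by
  exact Iff.rfl

theorem partH_of_mem (p : ZMod 2) : ∀ x ∈ D.gradeH p, D.partH p x = x := by
  intro x hx
  obtain ⟨a, ha, rfl⟩ := D.mem_gradeH.1 hx
  rw [partH_toH]
  congr 1
  exact Subtype.ext (D.part_of_mem ha)

theorem partH_add_one_of_mem (p : ZMod 2) : ∀ x ∈ D.gradeH p, D.partH (p + 1) x = 0 := by
  intro x hx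
  obtain ⟨a, ha, rfl⟩ := D.mem_gradeH.1 hx
  rw [partH_toH, ← D.toH.map_zero]
  congr 1
  exact Subtype.ext (D.part_of_mem_ne ha fun h => one_ne_zero (left_eq_add.1 h))

/-- The induced projections separate the two parts, and splitting a representing cocycle shows that
they span. -/
theorem isInternal_gradeH : DirectSum.IsInternal D.gradeH := by
  rw [DirectSum.isInternal_submodule_iff_isCompl D.gradeH (i := 0) (j := 1) (by decide)
    (by ext p; simpa using zmod_two_eq_zero_or_one p)]
  constructor
  · rw [Submodule.disjoint_def]
    intro x h0 h1
    rw [← D.partH_of_mem 1 x h1]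
    simpa using D.partH_add_one_of_mem 0 x h0
  · rw [codisjoint_iff, eq_top_iff]
    intro x _
    obtain ⟨a, rfl⟩ := Submodule.mkQ_surjective _ x
    rw [Submodule.mem_sup]
    refine ⟨_, D.mem_gradeH.2 ⟨⟨D.part 0 a, D.part_mem_ker 0 a a.2⟩, D.part_mem 0 _, rfl⟩,
      _, D.mem_gradeH.2 ⟨⟨D.part 1 a, D.part_mem_ker 1 a a.2⟩, D.part_mem 1 _, rfl⟩, ?_⟩
    rw [← map_add]
    congr 1
    exact Subtype.ext (D.part_add_part _)

theorem mH_mem_gradeH (p q : ZMod 2) :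
    ∀ x ∈ D.gradeH p, ∀ y ∈ D.gradeH q, D.mH x y ∈ D.gradeH (p + q) := by
  intro x hx y hy
  obtain ⟨a, ha, rfl⟩ := D.mem_gradeH.1 hx
  obtain ⟨b, hb, rfl⟩ := D.mem_gradeH.1 hy
  exact D.mem_gradeH.2 ⟨_, D.m_mem p q _ ha _ hb, rfl⟩

/-- The cohomology as a non-unital ring, if the induced product is associative. -/
abbrev nonUnitalRingH
    (hassoc : ∀ x y z : D.H, D.mH (D.mH x y) z = D.mH x (D.mH y z)) : NonUnitalRing D.H :=
  { (inferInstance : AddCommGroup D.H) with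
    mul := fun x y => D.mH x y
    left_distrib := fun _ _ _ => map_add _ _ _
    right_distrib := fun _ _ _ => LinearMap.map_add₂ _ _ _ _
    zero_mul := fun _ => LinearMap.map_zero₂ _ _
    mul_zero := fun _ => map_zero _
    mul_assoc := hassoc }

/-- The operators `Φ_Δ` preserve cocycles, and they induce the Koszul brackets of the induced
operator on cohomology. -/
theorem toH_phiAux {Δ : V →ₗ[k] V} (hk : ∀ a ∈ LinearMap.ker D.Q, Δ a ∈ LinearMap.ker D.Q)
    (hr : ∀ a ∈ LinearMap.range D.Q, Δ a ∈ LinearMap.range D.Q) (n : ℕ)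
    (w : Fin n → LinearMap.ker D.Q) (y : LinearMap.ker D.Q) :
    ∃ h : D.phiAux Δ n (fun i => (w i : V)) y ∈ LinearMap.ker D.Q,
      D.toH ⟨_, h⟩ = KoszulBracket.multilinearPhi D.mH (D.partH 0) (D.partH 1) (D.mapH Δ hk hr) n
        (fun i => D.toH (w i)) (D.toH y) := by
  induction n generalizing y with
  | zero => exact ⟨hk _ y.2, rfl⟩
  | succ n ih =>
    let x := w (Fin.last n)
    let w' : Fin n → LinearMap.ker D.Q := Fin.init w
    let P (p : ZMod 2) (a : LinearMap.ker D.Q) : LinearMap.ker D.Q :=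
      ⟨D.part p a, D.part_mem_ker p a a.2⟩
    obtain ⟨h1, e1⟩ := ih w' ⟨D.m x y, D.m_mem_ker x.2 y.2⟩
    obtain ⟨h2, e2⟩ := ih w' x
    obtain ⟨h3, e3⟩ := ih w' y
    obtain ⟨h4, e4⟩ := ih (fun i => P 0 (w' i) - P 1 (w' i)) y
    refine ⟨sub_mem (sub_mem h1 (D.m_mem_ker h2 y.2))
      (sub_mem (D.m_mem_ker (P 0 x).2 h3) (D.m_mem_ker (P 1 x).2 h4)), ?_⟩
    rw [KoszulBracket.multilinearPhi_succ]
    have e5 : (fun i => (D.partH 0 - D.partH 1)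
        ((Fin.init fun i => D.toH (w i) : Fin n → D.H) i)) =
        fun i => D.toH (P 0 (w' i) - P 1 (w' i)) := rfl
    have e6 : (Fin.init fun i => D.toH (w i) : Fin n → D.H) = fun i => D.toH (w' i) := rfl
    rw [e5, e6, mH_toH, ← e1, ← e2, ← e3, ← e4]
    rfl

end DiffSuperalgebra

/-! ### The sh-Lie structure on cohomology -/

theorem mainTheorem2 {k V : Type*} [Field k] [CharZero k] [AddCommGroup V] [Module k V]
    (D : DiffSuperalgebra k V)
    (hcomm : ∀ p q : ZMod 2, ∀ x ∈ D.gradeH p, ∀ y ∈ D.gradeH q,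
      D.mH x y = paritySign (p * q) • D.mH y x)
    (hassoc : ∀ x y z : D.H, D.mH (D.mH x y) z = D.mH x (D.mH y z))
    (Δ : V →ₗ[k] V)
    (hΔ_odd : ∀ p : ZMod 2, ∀ a ∈ D.grade p, Δ a ∈ D.grade (p + 1))
    (hΔ_sq : ∀ a : V, Δ (Δ a) = 0)
    (hQΔ : ∀ a : V, D.Q (Δ a) + Δ (D.Q a) = 0) :
    ∃ hker : ∀ (n : ℕ) (a : Fin (n + 1) → V),
        (∀ i, a i ∈ LinearMap.ker D.Q) → D.Phi Δ n a ∈ LinearMap.ker D.Q,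
      (∀ (n : ℕ) (a : Fin (n + 1) → V),
        (∀ i, a i ∈ LinearMap.ker D.Q) → (∃ i, a i ∈ LinearMap.range D.Q) →
          D.Phi Δ n a ∈ LinearMap.range D.Q) ∧
      ∃ bracket : (n : ℕ) → MultilinearMap k (fun _ : Fin (n + 1) => D.H) D.H,
        (∀ (n : ℕ) (a : Fin (n + 1) → LinearMap.ker D.Q),
          bracket n (fun i => D.toH (a i)) =
            D.toH ⟨D.Phi Δ n (fun i => (a i : V)), hker n _ (fun i => (a i).2)⟩) ∧
        IsShLie D.gradeH bracket := by
  have hk : ∀ a ∈ LinearMap.ker D.Q, Δ a ∈ LinearMap.ker D.Q := fun a ha => by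
    have h := hQΔ a
    rw [LinearMap.mem_ker] at ha ⊢
    rwa [ha, map_zero, add_zero] at h
  have hr : ∀ a ∈ LinearMap.range D.Q, Δ a ∈ LinearMap.range D.Q := by
    rintro _ ⟨b, rfl⟩
    -- Anticommutation gives `Δ (Q b) = Q (-Δ b)`.
    refine ⟨-Δ b, ?_⟩
    rw [map_neg, neg_eq_iff_add_eq_zero]
    exact hQΔ b
  let bracket : (n : ℕ) → MultilinearMap k (fun _ : Fin (n + 1) => D.H) D.H := fun n =>
    MultilinearMap.uncurryRight (M := fun _ => D.H)
      (KoszulBracket.multilinearPhi D.mH (D.partH 0) (D.partH 1) (D.mapH Δ hk hr) n)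
  have hPhi : ∀ (n : ℕ) (a : Fin (n + 1) → LinearMap.ker D.Q),
      ∃ h : D.Phi Δ n (fun i => (a i : V)) ∈ LinearMap.ker D.Q,
        D.toH ⟨_, h⟩ = bracket n fun i => D.toH (a i) := fun n a =>
    D.toH_phiAux hk hr n (Fin.init a) (a (Fin.last n))
  refine ⟨fun n a ha => (hPhi n fun i => ⟨a i, ha i⟩).1, fun n a ha ⟨i, hi⟩ => ?_, bracket,
    fun n a => (hPhi n a).2.symm, ?_⟩
  · obtain ⟨h, e⟩ := hPhi n fun i => ⟨a i, ha i⟩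
    -- A coboundary has class zero, and a multilinear map vanishes when one argument does.
    have h0 : D.toH ⟨a i, ha i⟩ = 0 := (Submodule.Quotient.mk_eq_zero _).2 hi
    rw [(bracket n).map_coord_zero i h0] at e
    exact (Submodule.Quotient.mk_eq_zero
      ((LinearMap.range D.Q).submoduleOf (LinearMap.ker D.Q))).1 e
  · let _ := D.nonUnitalRingH hassoc
    let 𝒜 : ZMod 2 → AddSubgroup D.H := fun p => (D.gradeH p).toAddSubgroup
    have hΔH : ∀ p, ∀ x ∈ 𝒜 p, (D.mapH Δ hk hr).toAddMonoidHom x ∈ 𝒜 (p + 1) := by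
      intro p x hx
      obtain ⟨a, ha, rfl⟩ := D.mem_gradeH.1 hx
      exact D.mem_gradeH.2 ⟨_, hΔ_odd p _ ha, rfl⟩
    have hsq : ∀ x, (D.mapH Δ hk hr).toAddMonoidHom ((D.mapH Δ hk hr).toAddMonoidHom x) = 0 := by
      intro x
      obtain ⟨a, rfl⟩ := Submodule.mkQ_surjective _ x
      refine (congrArg D.toH (Subtype.ext ?_)).trans D.toH.map_zero
      exact hΔ_sq a
    have hb : ∀ n (p : Fin (n + 1) → ZMod 2) (a : Fin (n + 1) → D.H), (∀ i, a i ∈ 𝒜 (p i)) →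
        bracket n a = KoszulBracket.phiList (D.mapH Δ hk hr).toAddMonoidHom
          (List.ofFn fun i => (p i, a i)).reverse := by
      intro n p a ha
      rw [List.ofFn_succ', List.concat_eq_append, List.reverse_append]
      exact KoszulBracket.multilinearPhi_eq_phi (P := D.partH) (fun _ _ => rfl) D.partH_of_mem
        D.partH_add_one_of_mem (fun i => ha i.castSucc) _
    refine ⟨D.isInternal_gradeH, fun n p a ha => ?_, fun n p a ha σ => ?_, fun n p a ha => ?_⟩
    · rw [hb n p a ha, ← KoszulBracket.parity_reverse_ofFn p a]
      exact KoszulBracket.phiList_mem (𝒜 := 𝒜) D.mH_mem_gradeH hΔH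
        (KoszulBracket.homogeneous_reverse_ofFn ha)
    · exact KoszulBracket.bracket_symm (𝒜 := 𝒜) (bracket := fun n a => bracket n a) hcomm
        D.mH_mem_gradeH hΔH hb n p a ha σ
    · exact KoszulBracket.bracket_jacobi (𝒜 := 𝒜) (bracket := fun n a => bracket n a) hcomm
        D.mH_mem_gradeH hΔH hsq hb n p a ha
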